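/- For integers $n,e\ge 0$ let $S_{n,e}$ denote the finite-dimensional complex vector space of homogeneous polynomials (forms) of degree $e$ in $n$ variables with complex coefficients, the zero form included. A property is said to hold for a general form of degree $e$ if it holds for all forms in some nonempty Zariski open subset of $S_{n,e}$. For $f\in S_{n,kd}$, the $k$-rank $\mathrm{rk}_k(f)$ is the smallest $s$ such that $f=g_1^k+\dots+g_s^k$ for some $g_1,\dots,g_s\in S_{n,d}$ (and $\infty$ if there is no such $s$). The generic $k$-rank $\mathrm{rk}_k^\circ(n,kd)$ is the smallest $s$ such that a general form of degree $kd$ in $n$ variables is a sum of $s$ $k$-th powers of forms of degree $d$ (and $\infty$ if there is no such $s$). **Theorem.** Let $k,d\ge 2$ be integers. Then the generic $k$-rank of binary forms of degree $kd$ is $$\mathrm{rk}_k^\circ(2,kd)=\left\lceil\frac{kd+1}{d+1}\right\rceil .$$ Moreover, a general binary form $f$ of degree $kd$ satisfies $\mathrm{rk}_k(f)=\left\lceil\frac{kd+1}{d+1}\right\rceil$, and this number is also the smallest $s\ge 0$ for which the $s$-th secant variety of the variety of $k$-th powers $\{[g^k] : 0\ne g\in S_{2,d}\}\subset\mathbb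 P(S_{2,kd})$ is all of $\mathbb P(S_{2,kd})$. Here the $s$-th secant variety is the Zariski closure of the union of the projectivized linear spans $\mathbb P\langle g_1^k,\dots,g_s^k\rangle$ over all $g_1,\dots,g_s\in S_{2,d}$; equivalently, the Zariski closure in $S_{2,kd}$ of the union of the spans $\langle g_1^k,\dots,g_s^k\rangle$ is all of $S_{2,kd}$. -/

import Mathlib

noncomputable section

/-- Complex forms (homogeneous polynomials, zero included) of degree `e` in `n` variables. -/
abbrev Form (n e : ℕ) : Type := ↥(MvPolynomial.homogeneousSubmodule (Fin n) ℂ e)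

/-- The value at the form `f` of a polynomial `P` in the coefficients of forms: the variable of `P`
with index `m` is replaced by the coefficient of the monomial `m` in `f`. As `P` varies, these are
exactly the polynomial functions on the finite-dimensional vector space `Form n e` (a variable
indexed by a monomial of degree other than `e` is the function zero on `Form n e`). -/
def evalCoeffs {n e : ℕ} (P : MvPolynomial (Fin n →₀ ℕ) ℂ) (f : Form n e) : ℂ :=
  MvPolynomial.eval (fun m => MvPolynomial.coeff m (f : MvPolynomial (Fin n) ℂ)) P

/-- The general form of degree `e` in `n` variables has the property `p`: the forms with property
`p` contain a nonempty Zariski open set of the space of forms (equivalently, a nonempty basic open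
set, the non-vanishing locus of a polynomial function that is not identically zero). -/
def HoldsForGeneralForm {n e : ℕ} (p : Form n e → Prop) : Prop :=
  ∃ P : MvPolynomial (Fin n →₀ ℕ) ℂ,
    (∃ f : Form n e, evalCoeffs P f ≠ 0) ∧ ∀ f : Form n e, evalCoeffs P f ≠ 0 → p f

/-- The Zariski closure of a set of forms in the affine space of all forms of that degree. -/
def zariskiClosure {n e : ℕ} (A : Set (Form n e)) : Set (Form n e) :=
  {f | ∀ P : MvPolynomial (Fin n →₀ ℕ) ℂ, (∀ g ∈ A, evalCoeffs P g = 0) → evalCoeffs P f = 0}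

/-- `f` is a sum of `s` `k`-th powers of forms of degree `d` (equivalently, of at most `s`, since
the form zero is allowed as a summand). -/
def IsSumOfPowers {n : ℕ} (k d s : ℕ) (f : Form n (k * d)) : Prop :=
  ∃ g : Fin s → Form n d,
    (f : MvPolynomial (Fin n) ℂ) = ∑ i, (g i : MvPolynomial (Fin n) ℂ) ^ k

/-- The `k`-rank of a form `f` of degree `k * d`: the smallest number of `k`-th powers of forms of
degree `d` whose sum is `f`, and `⊤` if `f` is no such sum. -/
def kRank {n : ℕ} (k d : ℕ) (f : Form n (k * d)) : ℕ∞ :=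
  sInf {r : ℕ∞ | ∃ s : ℕ, r = s ∧ IsSumOfPowers k d s f}

/-- The generic `k`-rank of forms of degree `k * d` in `n` variables: the smallest `s` such that
the general form of degree `k * d` is a sum of `s` `k`-th powers of forms of degree `d`, and `⊤` if
there is none. -/
def genericKRank (n k d : ℕ) : ℕ∞ :=
  sInf {r : ℕ∞ | ∃ s : ℕ, r = s ∧
    HoldsForGeneralForm fun f : Form n (k * d) => IsSumOfPowers k d s f}

/-- The affine cone, in the space of forms of degree `k * d`, over the `s`-th secant variety of the
variety of `k`-th powers: the Zariski closure of the union of the linear spans of `g₁ᵏ, …, gₛᵏ`,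
where `g₁, …, gₛ` are forms of degree `d`. It is the whole space of forms if and only if the secant
variety is the whole projective space. -/
def secantCone (n k d s : ℕ) : Set (Form n (k * d)) :=
  zariskiClosure {f | ∃ g : Fin s → Form n d, (f : MvPolynomial (Fin n) ℂ) ∈
    Submodule.span ℂ (Set.range fun i => (g i : MvPolynomial (Fin n) ℂ) ^ k)}

end

/-! Everything rests on the map (g₁, …, gₛ) ↦ ∑ gᵢᵏ from an affine space of dimension s(d+1) to one
of dimension kd+1.

If s(d+1) < kd+1, its components are algebraically dependent, so a nonzero polynomial vanishes on
all sums of s powers (`exists_evalCoeffs_ne_zero_of_lt`).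

If s(d+1) ≥ kd+1, the differential is onto at gᵢ = ℓᵢᵈ with ℓᵢ = 1 + iX. Its image is ∑ gᵢᵏ⁻¹ S_d,
and a functional killing this corresponds to a polynomial of degree at most kd with s distinct roots
of multiplicity at least d+1, hence to zero (`apply_X_pow_eq_zero_of_apply_one_add_pow_eq_zero`). So
the components are algebraically independent, and by Chevalley's theorem the image contains a
nonempty open set.

Over ℂ, k-th roots absorb scalars, so spans of k-th powers give nothing beyond sums, and the secant
statement follows. -/

open Topology Polynomial

/-! ### Dominant polynomial maps -/

/-- A constructible subset of the prime spectrum of a domain which contains the generic point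
contains a nonempty basic open set. -/
theorem PrimeSpectrum.exists_basicOpen_subset_of_isConstructible {R : Type*} [CommRing R]
    [IsDomain R] {Z : Set (PrimeSpectrum R)} (hZ : IsConstructible Z) (h : ⊥ ∈ Z) :
    ∃ a : R, a ≠ 0 ∧ (PrimeSpectrum.basicOpen a : Set (PrimeSpectrum R)) ⊆ Z := by
  obtain ⟨S, rfl⟩ := PrimeSpectrum.exists_constructibleSetData_iff.mpr hZ
  simp only [PrimeSpectrum.ConstructibleSetData.toSet, Set.mem_iUnion] at h
  obtain ⟨c, hc, hg, hf⟩ := h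
  refine ⟨c.f, fun h0 => hf ?_, fun q hq => ?_⟩
  · simp [h0]
  · simp only [PrimeSpectrum.ConstructibleSetData.toSet, Set.mem_iUnion]
    refine ⟨c, hc, ?_, ?_⟩
    -- The closed part contains the generic point, so all its equations are zero.
    · rw [PrimeSpectrum.mem_zeroLocus] at hg ⊢
      intro x hx
      have : x = 0 := by simpa using hg hx
      simp [this]
    · simpa [PrimeSpectrum.mem_zeroLocus] using hq

/-- The image of a dominant polynomial map of affine spaces over an algebraically closed field
contains a nonempty basic open set. -/
theorem AlgebraicIndependent.exists_forall_eval_ne_zero_exists_eval_eq {K σ τ : Type*} [Field K]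
    [IsAlgClosed K] [Finite σ] [Finite τ] {φ : τ → MvPolynomial σ K}
    (hφ : AlgebraicIndependent K φ) :
    ∃ P : MvPolynomial τ K, P ≠ 0 ∧ ∀ y : τ → K, MvPolynomial.eval y P ≠ 0 →
      ∃ x : σ → K, ∀ j, MvPolynomial.eval x (φ j) = y j := by
  set f : MvPolynomial τ K →+* MvPolynomial σ K := (MvPolynomial.aeval φ).toRingHom with hf
  have hinj : Function.Injective f := hφ
  have hfin : f.FinitePresentation := by
    rw [← RingHom.FinitePresentation.of_finiteType]
    refine RingHom.FiniteType.of_comp_finiteType (f := (MvPolynomial.C : K →+* _)) ?_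
    have : f.comp MvPolynomial.C = (algebraMap K (MvPolynomial σ K)) := by
      ext x; simp [hf, MvPolynomial.algebraMap_eq]
    rw [this, RingHom.finiteType_algebraMap]
    infer_instance
  obtain ⟨P, hP, hsub⟩ := PrimeSpectrum.exists_basicOpen_subset_of_isConstructible
    (PrimeSpectrum.isConstructible_range_comap hfin) ⟨⊥, by
      ext x
      simp [Ideal.mem_comap, map_eq_zero_iff f hinj]⟩
  refine ⟨P, hP, fun y hy => ?_⟩
  obtain ⟨q, hq⟩ := hsub (show (⟨RingHom.ker (MvPolynomial.eval y), RingHom.ker_isPrime _⟩ :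
    PrimeSpectrum (MvPolynomial τ K)) ∈ _ from hy)
  -- By the Nullstellensatz, a maximal ideal above `q` is a point `x`; it still contains every `φ j
  -- - y j`.
  obtain ⟨m, hm, hqm⟩ := Ideal.exists_le_maximal q.asIdeal q.2.ne_top
  obtain ⟨x, rfl⟩ := (MvPolynomial.isMaximal_iff_eq_vanishingIdeal_singleton).1 hm
  refine ⟨x, fun j => ?_⟩
  have h1 : MvPolynomial.X j - MvPolynomial.C (y j) ∈ (PrimeSpectrum.comap f q).asIdeal := by
    rw [hq]
    simp [RingHom.mem_ker]
  have h2 := hqm (Ideal.mem_comap.1 h1)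
  rw [MvPolynomial.mem_vanishingIdeal_singleton_iff] at h2
  simpa [hf, sub_eq_zero, MvPolynomial.aeval_eq_eval] using h2

/-- Polynomials are algebraically independent if the image of the polynomial map which they define
is a neighbourhood of some point. -/
theorem algebraicIndependent_of_range_mem_nhds {𝕜 σ τ : Type*} [NontriviallyNormedField 𝕜]
    [Finite τ] {φ : τ → MvPolynomial σ 𝕜} {y : τ → 𝕜}
    (h : Set.range (fun (x : σ → 𝕜) j => MvPolynomial.eval x (φ j)) ∈ 𝓝 y) :
    AlgebraicIndependent 𝕜 φ := by
  have := Fintype.ofFinite τ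
  rw [algebraicIndependent_iff]
  intro P hP
  obtain ⟨ε, hε, hball⟩ := Metric.mem_nhds_iff.1 h
  refine MvPolynomial.funext_set (fun j => Metric.ball (y j) ε)
    (fun j => infinite_of_mem_nhds (y j) (Metric.ball_mem_nhds _ hε)) fun z hz => ?_
  rw [← ball_pi _ hε] at hz
  obtain ⟨x, rfl⟩ := hball hz
  have := congrArg (MvPolynomial.eval x) hP
  rw [map_zero, MvPolynomial.aeval_def, MvPolynomial.algebraMap_eq, MvPolynomial.eval₂_eq'] at this
  rw [map_zero, MvPolynomial.eval_eq', ← this]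
  simp

/-- Jacobian criterion: polynomials are algebraically independent if the polynomial map which they
define has a surjective differential at some point. -/
theorem algebraicIndependent_of_range_fderiv_eq_top {𝕜 σ τ : Type*} [RCLike 𝕜]
    [Fintype σ] [Fintype τ] {φ : τ → MvPolynomial σ 𝕜} (x : σ → 𝕜)
    (h : (fderiv 𝕜 (fun (x : σ → 𝕜) j => MvPolynomial.eval x (φ j)) x).range = ⊤) :
    AlgebraicIndependent 𝕜 φ := by
  have hs : HasStrictFDerivAt (fun (x : σ → 𝕜) j => MvPolynomial.eval x (φ j))
      (fderiv 𝕜 (fun (x : σ → 𝕜) j => MvPolynomial.eval x (φ j)) x) x :=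
    (AnalyticAt.pi fun j =>
      AnalyticOnNhd.eval_mvPolynomial (φ j) x (Set.mem_univ x)).hasStrictFDerivAt
  refine algebraicIndependent_of_range_mem_nhds
    (y := fun j => MvPolynomial.eval x (φ j)) ?_
  rw [← hs.map_nhds_eq_of_surj h]
  exact Filter.range_mem_map

/-! ### Apolarity -/

/-- A linear functional on polynomials of degree at most `N` which vanishes on
`X ^ m * (1 + a i * X) ^ (N - m)` for all `m ≤ d` and sufficiently many distinct `a i` is zero. -/
theorem Polynomial.apply_X_pow_eq_zero_of_apply_one_add_pow_eq_zero {K ι : Type*} [Field K]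
    [CharZero K] [Fintype ι] {N d : ℕ} (hd : d ≤ N) (hN : N < Fintype.card ι * (d + 1)) {a : ι → K}
    (ha : Function.Injective a) (φ : K[X] →ₗ[K] K)
    (h : ∀ i, ∀ m ≤ d, φ (X ^ m * (1 + C (a i) * X) ^ (N - m)) = 0) {j : ℕ} (hj : j ≤ N) :
    φ (X ^ j) = 0 := by
  -- F(t) = φ((1 + tX)^N), so the m-th Taylor coefficient of F at a is (N choose m) φ(X^m (1 +
  -- aX)^(N-m)).
  set F : K[X] := ∑ j ∈ Finset.range (N + 1), monomial j ((N.choose j : K) * φ (X ^ j)) with hF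
  have hcoeff : ∀ j ≤ N, F.coeff j = (N.choose j : K) * φ (X ^ j) := by
    intro j hj
    simp [hF, coeff_monomial, Nat.lt_succ_of_le hj]
  have hdeg : F.natDegree ≤ N := by
    refine natDegree_sum_le_of_forall_le _ _ fun j hj => ?_
    exact (natDegree_monomial_le _).trans (Nat.lt_succ_iff.1 (Finset.mem_range.1 hj))
  have htaylor : ∀ i, ∀ m ≤ d, (taylor (a i) F).coeff m = 0 := by
    intro i m hm
    have hmN := hm.trans hd
    have h1 := h i m hm
    rw [add_comm (1 : K[X]), add_pow, Finset.mul_sum, map_sum] at h1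
    rw [taylor_coeff, hF, map_sum, eval_finsetSum]
    simp only [hasseDeriv_monomial, eval_monomial]
    obtain ⟨e, rfl⟩ := Nat.exists_eq_add_of_le hmN
    rw [add_assoc, Finset.sum_range_add, Finset.sum_eq_zero (s := Finset.range m), zero_add]
    · rw [Nat.add_sub_cancel_left] at h1
      rw [← mul_zero (((m + e).choose m : ℕ) : K), ← h1, Finset.mul_sum]
      refine Finset.sum_congr rfl fun l hl => ?_
      have hle : l ≤ e := Nat.lt_succ_iff.1 (Finset.mem_range.1 hl)
      have hch := Nat.choose_mul (n := m + e) (k := m + l) (s := m) (by omega)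
      rw [Nat.add_sub_cancel_left, Nat.add_sub_cancel_left] at hch
      have hX : (X : K[X]) ^ m * ((C (a i) * X) ^ l * 1 ^ (e - l) * ((e.choose l : ℕ) : K[X])) =
          (a i ^ l * (e.choose l : K)) • X ^ (m + l) := by
        rw [smul_eq_C_mul]
        simp only [mul_pow, one_pow, map_mul, map_pow, map_natCast]
        ring
      rw [hX, map_smul, smul_eq_mul, Nat.add_sub_cancel_left]
      have hch' : ((m + e).choose (m + l) : K) * ((m + l).choose m : K) =
        ((m + e).choose m : K) * (e.choose l : K) := by exact_mod_cast hch
      linear_combination (φ (X ^ (m + l)) * a i ^ l) * hch'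
    · intro l hl
      rw [Nat.choose_eq_zero_of_lt (Finset.mem_range.1 hl)]
      simp
  have hdvd : ∀ i, (X - C (a i)) ^ (d + 1) ∣ F := by
    intro i
    have : X ^ (d + 1) ∣ taylor (a i) F := by
      rw [X_pow_dvd_iff]
      exact fun m hm => htaylor i m (Nat.lt_succ_iff.1 hm)
    obtain ⟨G, hG⟩ := this
    refine ⟨taylor (-a i) G, ?_⟩
    have h2 := congrArg (taylor (-a i)) hG
    rw [taylor_taylor, taylor_mul] at h2
    simpa [taylor_pow, sub_eq_add_neg] using h2
  have hprod : (∏ i, (X - C (a i)) ^ (d + 1)) ∣ F := by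
    refine Finset.prod_dvd_of_coprime (fun i _ j _ hij => ?_) fun i _ => hdvd i
    exact (isCoprime_X_sub_C_of_isUnit_sub
      (sub_ne_zero.2 (ha.ne hij)).isUnit).pow
  have hF0 : F = 0 := by
    by_contra hne
    have := natDegree_le_of_dvd hprod hne
    rw [natDegree_prod_of_monic _ _ fun i _ => (monic_X_sub_C _).pow _] at this
    simp [natDegree_pow] at this
    omega
  have := hcoeff j hj
  rw [hF0, coeff_zero] at this
  exact (mul_eq_zero.1 this.symm).resolve_left
    (by exact_mod_cast (Nat.choose_pos hj).ne')

/-! ### The sum-of-powers map and its differential -/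

/-- The polynomial with given coefficients. -/
noncomputable def Polynomial.ofCoeffs {R : Type*} [Semiring R] {n : ℕ} (c : Fin n → R) : R[X] :=
  ∑ l : Fin n, monomial (l : ℕ) (c l)

theorem Polynomial.coeff_ofCoeffs {R : Type*} [Semiring R] {n : ℕ} (c : Fin n → R) (j : Fin n) :
    (ofCoeffs c).coeff j = c j := by
  simp [ofCoeffs, coeff_monomial, Fin.val_inj]

theorem Polynomial.natDegree_ofCoeffs_le {R : Type*} [Semiring R] {n : ℕ} (c : Fin (n + 1) → R) :
    (ofCoeffs c).natDegree ≤ n :=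
  natDegree_sum_le_of_forall_le _ _ fun l _ =>
    (natDegree_monomial_le _).trans (Nat.lt_succ_iff.1 l.2)

theorem Polynomial.ofCoeffs_coeff {R : Type*} [Semiring R] {n : ℕ} {p : R[X]}
    (hp : p.natDegree ≤ n) : ofCoeffs (fun l : Fin (n + 1) => p.coeff l) = p := by
  conv_rhs => rw [p.as_sum_range' (n + 1) (Nat.lt_succ_of_le hp)]
  exact Fin.sum_univ_eq_sum_range (fun i => monomial i (p.coeff i)) (n + 1)

theorem Polynomial.map_ofCoeffs {R S : Type*} [Semiring R] [Semiring S] {n : ℕ} (f : R →+* S)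
    (c : Fin n → R) : (ofCoeffs c).map f = ofCoeffs (f ∘ c) := by
  simp [ofCoeffs, Polynomial.map_sum]

theorem Polynomial.ofCoeffs_add {R : Type*} [Semiring R] {n : ℕ} (b c : Fin n → R) :
    ofCoeffs (b + c) = ofCoeffs b + ofCoeffs c := by
  simp [ofCoeffs, Finset.sum_add_distrib]

theorem Polynomial.ofCoeffs_smul {R : Type*} [Semiring R] {n : ℕ} (r : R) (c : Fin n → R) :
    ofCoeffs (r • c) = r • ofCoeffs c := by
  simp [ofCoeffs, Finset.smul_sum, smul_monomial]

/-- The coefficients of the sum of the `k`-th powers of `s` polynomials of degree at most `d`, as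
polynomials in the coefficients of these polynomials. -/
noncomputable def sumPowCoeff (k d s N : ℕ) (j : Fin (N + 1)) :
    MvPolynomial (Fin s × Fin (d + 1)) ℂ :=
  (∑ i : Fin s, ofCoeffs (fun l : Fin (d + 1) => MvPolynomial.X (R := ℂ) (i, l)) ^ k).coeff j

theorem eval_sumPowCoeff (k d s N : ℕ) (j : Fin (N + 1)) (x : Fin s × Fin (d + 1) → ℂ) :
    MvPolynomial.eval x (sumPowCoeff k d s N j) =
      (∑ i : Fin s, ofCoeffs (fun l : Fin (d + 1) => x (i, l)) ^ k).coeff j := by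
  rw [sumPowCoeff, ← coeff_map, Polynomial.map_sum]
  simp [map_ofCoeffs, Function.comp_def]

theorem hasDerivAt_coeff_mul {𝕜 : Type*} [NontriviallyNormedField 𝕜] {p q : 𝕜 → 𝕜[X]} {p' q' : 𝕜[X]}
    {t : 𝕜} (hp : ∀ j, HasDerivAt (fun t => (p t).coeff j) (p'.coeff j) t)
    (hq : ∀ j, HasDerivAt (fun t => (q t).coeff j) (q'.coeff j) t) (j : ℕ) :
    HasDerivAt (fun t => (p t * q t).coeff j) ((p' * q t + p t * q').coeff j) t := by
  simp only [coeff_add, coeff_mul, ← Finset.sum_add_distrib]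
  exact HasDerivAt.fun_sum fun i _ => (hp i.1).mul (hq i.2)

theorem hasDerivAt_coeff_pow {𝕜 : Type*} [NontriviallyNormedField 𝕜] {p : 𝕜 → 𝕜[X]} {p' : 𝕜[X]}
    {t : 𝕜} (hp : ∀ j, HasDerivAt (fun t => (p t).coeff j) (p'.coeff j) t) (k j : ℕ) :
    HasDerivAt (fun t => (p t ^ (k + 1)).coeff j)
      ((((k + 1 : ℕ) : 𝕜[X]) * p t ^ k * p').coeff j) t := by
  induction k generalizing j with
  | zero => simpa using hp j
  | succ k ih =>
    have := hasDerivAt_coeff_mul ih hp j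
    simp only [← pow_succ] at this
    convert this using 2
    push_cast
    ring

/-- Both sides are derivatives at t = 0 along the line `x + t • h`; the product rule is applied
coefficientwise. -/
theorem fderiv_sumPowCoeff_apply (k d s N : ℕ) (x h : Fin s × Fin (d + 1) → ℂ) (j : Fin (N + 1)) :
    fderiv ℂ (fun (x : Fin s × Fin (d + 1) → ℂ) j =>
      MvPolynomial.eval x (sumPowCoeff (k + 1) d s N j)) x h j =
      (∑ i : Fin s, ((k + 1 : ℕ) : ℂ[X]) * ofCoeffs (fun l : Fin (d + 1) => x (i, l)) ^ k *
        ofCoeffs (fun l : Fin (d + 1) => h (i, l))).coeff j := by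
  have hd : HasFDerivAt (fun (x : Fin s × Fin (d + 1) → ℂ) j =>
      MvPolynomial.eval x (sumPowCoeff (k + 1) d s N j)) (fderiv ℂ (fun
      (x : Fin s × Fin (d + 1) → ℂ) j =>
      MvPolynomial.eval x (sumPowCoeff (k + 1) d s N j)) x) (x + (0 : ℂ) • h) := by
    rw [zero_smul, add_zero]
    exact (AnalyticAt.pi fun j => AnalyticOnNhd.eval_mvPolynomial
      (sumPowCoeff (k + 1) d s N j) x (Set.mem_univ x)).differentiableAt.hasFDerivAt
  have hline : HasDerivAt (fun t : ℂ => x + t • h) h 0 := by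
    simpa using ((hasDerivAt_id (0 : ℂ)).smul_const h).const_add x
  have h1 := hasDerivAt_pi.1 (hd.comp_hasDerivAt (0 : ℂ) hline) j
  refine h1.unique ?_
  simp only [Function.comp_def, eval_sumPowCoeff, finsetSum_coeff]
  refine HasDerivAt.fun_sum fun i _ => ?_
  have h2 : ∀ j, HasDerivAt (fun t : ℂ =>
      (ofCoeffs (fun l : Fin (d + 1) => (x + t • h) (i, l))).coeff j)
      ((ofCoeffs (fun l : Fin (d + 1) => h (i, l))).coeff j) 0 := by
    intro j
    have : ∀ t : ℂ, (ofCoeffs (fun l : Fin (d + 1) => (x + t • h) (i, l))).coeff j =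
        (ofCoeffs (fun l : Fin (d + 1) => x (i, l))).coeff j +
          t * (ofCoeffs (fun l : Fin (d + 1) => h (i, l))).coeff j := by
      intro t
      rw [← smul_eq_mul, ← coeff_smul, ← coeff_add, ← ofCoeffs_smul, ← ofCoeffs_add]
      rfl
    simp only [this]
    simpa using ((hasDerivAt_id (0 : ℂ)).mul_const
      ((ofCoeffs (fun l : Fin (d + 1) => h (i, l))).coeff j)).const_add
        ((ofCoeffs (fun l : Fin (d + 1) => x (i, l))).coeff j)
  simpa using hasDerivAt_coeff_pow h2 k j

theorem exists_range_fderiv_sumPowCoeff_eq_top (k d s : ℕ)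
    (hs : (k + 1) * d + 1 ≤ s * (d + 1)) :
    ∃ x, (fderiv ℂ (fun (x : Fin s × Fin (d + 1) → ℂ) j =>
      MvPolynomial.eval x (sumPowCoeff (k + 1) d s ((k + 1) * d) j)) x).range = ⊤ := by
  set g : Fin s → ℂ[X] := fun i => (1 + C ((i : ℕ) : ℂ) * X) with hg
  have hgdeg : ∀ i n, (g i ^ n).natDegree ≤ n := by
    intro i n
    refine natDegree_pow_le_of_le n ?_ |>.trans (mul_one n).le
    exact natDegree_add_le_of_degree_le (by simp)
      ((natDegree_C_mul_le _ _).trans natDegree_X_le)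
  set x : Fin s × Fin (d + 1) → ℂ := fun il => (g il.1 ^ d).coeff il.2 with hx
  have hxg : ∀ i, ofCoeffs (fun l : Fin (d + 1) => x (i, l)) = g i ^ d :=
    fun i => ofCoeffs_coeff (hgdeg i d)
  refine ⟨x, ?_⟩
  by_contra hne
  obtain ⟨ψ, hψ0, hψ⟩ := Submodule.exists_le_ker_of_lt_top _ (lt_top_iff_ne_top.2 hne)
  -- Extends `ψ` to all polynomials by ignoring coefficients beyond degree (k+1)d.
  set φ : ℂ[X] →ₗ[ℂ] ℂ :=
    ψ ∘ₗ LinearMap.pi fun j : Fin ((k + 1) * d + 1) => lcoeff ℂ j with hφ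
  have hdN : d ≤ (k + 1) * d := Nat.le_mul_of_pos_left d k.succ_pos
  have key : ∀ i, ∀ m ≤ d, φ (X ^ m * (g i) ^ ((k + 1) * d - m)) = 0 := by
    intro i m hm
    set q : ℂ[X] := X ^ m * g i ^ (d - m) with hq
    have hqdeg : q.natDegree ≤ d := by
      refine natDegree_mul_le.trans ?_
      have := hgdeg i (d - m)
      rw [natDegree_X_pow]
      omega
    -- Moving only the i-th summand, in direction X^m ℓᵢ^(d-m), gives a multiple of ℓᵢ^(dk) · X^m
    -- ℓᵢ^(d-m).
    set v : Fin s × Fin (d + 1) → ℂ := fun il => if il.1 = i then q.coeff il.2 else 0 with hv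
    have h0 := LinearMap.mem_ker.1 (hψ (LinearMap.mem_range_self _ v))
    have hpoly : (∑ i' : Fin s, ((k + 1 : ℕ) : ℂ[X]) *
        ofCoeffs (fun l : Fin (d + 1) => x (i', l)) ^ k *
        ofCoeffs (fun l : Fin (d + 1) => v (i', l))) =
        ((k + 1 : ℕ) : ℂ) • (X ^ m * g i ^ ((k + 1) * d - m)) := by
      rw [Finset.sum_eq_single i]
      · have : ofCoeffs (fun l : Fin (d + 1) => v (i, l)) = q := by
          simp only [hv, if_true]
          exact ofCoeffs_coeff hqdeg
        rw [this, hxg, hq, smul_eq_C_mul, map_natCast, ← pow_mul,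
          show (k + 1) * d - m = d * k + (d - m) by rw [add_mul, one_mul, mul_comm]; omega, pow_add]
        ring
      · intro i' _ hi'
        simp [hv, hi', ofCoeffs]
      · simp
    have h1 : φ (((k + 1 : ℕ) : ℂ) • (X ^ m * g i ^ ((k + 1) * d - m))) = 0 := by
      rw [← h0, hφ, ← hpoly, LinearMap.comp_apply]
      congr 1
      ext j
      exact (fderiv_sumPowCoeff_apply k d s _ x v j).symm
    rw [map_smul, smul_eq_mul] at h1
    exact (mul_eq_zero.1 h1).resolve_left (by exact_mod_cast k.succ_ne_zero)
  have hzero := fun j (hj : j ≤ (k + 1) * d) =>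
    apply_X_pow_eq_zero_of_apply_one_add_pow_eq_zero hdN
      (by rw [Fintype.card_fin]; omega) (a := fun i : Fin s => ((i : ℕ) : ℂ))
      (fun i j hij => Fin.ext (Nat.cast_injective hij)) φ key hj
  apply hψ0
  refine LinearMap.pi_ext' fun j => LinearMap.ext_ring ?_
  have := hzero j (Nat.lt_succ_iff.1 j.2)
  rw [LinearMap.zero_comp, LinearMap.zero_apply, ← this, hφ, LinearMap.comp_apply,
    LinearMap.comp_apply]
  congr 1
  ext l
  simp [Pi.single_apply, coeff_X_pow, Fin.val_inj]

/-! ### Binary forms as coefficient vectors -/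

/-- The tuple of coefficients of a binary form. -/
noncomputable def binaryCoeffs {e : ℕ} (f : Form 2 e) (j : Fin (e + 1)) : ℂ :=
  (MvPolynomial.aeval ![X, 1] (f : MvPolynomial (Fin 2) ℂ) : ℂ[X]).coeff j

/-- The binary form with a given tuple of coefficients. -/
noncomputable def binaryForm {e : ℕ} (c : Fin (e + 1) → ℂ) : Form 2 e :=
  ⟨(ofCoeffs c).homogenize e, isHomogeneous_homogenize _⟩

theorem dehomogenize_binaryForm {e : ℕ} (c : Fin (e + 1) → ℂ) :
    MvPolynomial.aeval ![X, 1] (binaryForm c : MvPolynomial (Fin 2) ℂ) = ofCoeffs c :=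
  aeval_homogenize_X_one _ (natDegree_ofCoeffs_le c)

theorem binaryCoeffs_binaryForm {e : ℕ} (c : Fin (e + 1) → ℂ) : binaryCoeffs (binaryForm c) = c :=
  funext fun j => by rw [binaryCoeffs, dehomogenize_binaryForm, coeff_ofCoeffs]

theorem homogenize_dehomogenize {e : ℕ} (f : Form 2 e) :
    (MvPolynomial.aeval ![X, 1] (f : MvPolynomial (Fin 2) ℂ) : ℂ[X]).homogenize e = f :=
  homogenize_eq_of_isHomogeneous f.2 rfl

/-- The exponent vector of the monomial `x ^ j * y ^ (e - j)`. -/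
noncomputable def binaryExponent (e : ℕ) (j : Fin (e + 1)) : Fin 2 →₀ ℕ :=
  Finsupp.equivFunOnFinite.symm ![(j : ℕ), e - j]

theorem coeff_binaryExponent {e : ℕ} (f : Form 2 e) (j : Fin (e + 1)) :
    MvPolynomial.coeff (binaryExponent e j) (f : MvPolynomial (Fin 2) ℂ) = binaryCoeffs f j := by
  rw [binaryCoeffs, show MvPolynomial.coeff _ (f : MvPolynomial (Fin 2) ℂ) = _ by
    rw [← homogenize_dehomogenize f, coeff_homogenize]]
  simp [binaryExponent, Nat.add_sub_cancel' (Nat.lt_succ_iff.1 j.2)]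

theorem ofCoeffs_binaryCoeffs {e : ℕ} (f : Form 2 e) : ofCoeffs (binaryCoeffs f) =
    MvPolynomial.aeval ![X, 1] (f : MvPolynomial (Fin 2) ℂ) := by
  refine ofCoeffs_coeff ?_
  rw [natDegree_le_iff_coeff_eq_zero]
  intro j hj
  rw [MvPolynomial.aeval_def, MvPolynomial.eval₂_eq', finsetSum_coeff]
  refine Finset.sum_eq_zero fun m hm => ?_
  have hm' := f.2 (MvPolynomial.mem_support_iff.1 hm)
  simp only [Fin.prod_univ_two, Matrix.cons_val_zero, Matrix.cons_val_one, one_pow, mul_one,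
    algebraMap_eq, coeff_C_mul_X_pow]
  refine if_neg fun h => ?_
  simp [Finsupp.weight_apply, Finsupp.sum_fintype] at hm'
  omega

theorem binaryForm_binaryCoeffs {e : ℕ} (f : Form 2 e) : binaryForm (binaryCoeffs f) = f :=
  Subtype.ext <| by
    change (ofCoeffs (binaryCoeffs f)).homogenize e = f
    rw [ofCoeffs_binaryCoeffs, homogenize_dehomogenize]

theorem evalCoeffs_rename {e : ℕ} (Q : MvPolynomial (Fin (e + 1)) ℂ) (f : Form 2 e) :
    evalCoeffs (MvPolynomial.rename (binaryExponent e) Q) f =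
      MvPolynomial.eval (binaryCoeffs f) Q := by
  rw [evalCoeffs, MvPolynomial.eval_rename]
  congr 2
  exact funext fun j => coeff_binaryExponent f j

/-- Every polynomial function of the coefficients of binary forms of degree `e` is a polynomial in
the coefficients of the `e + 1` monomials of degree `e`. -/
theorem exists_evalCoeffs_eq_eval {e : ℕ} (P : MvPolynomial (Fin 2 →₀ ℕ) ℂ) :
    ∃ Q : MvPolynomial (Fin (e + 1)) ℂ, ∀ f : Form 2 e,
      evalCoeffs P f = MvPolynomial.eval (binaryCoeffs f) Q := by
  classical
  refine ⟨MvPolynomial.bind₁ (fun m => if h : m 0 + m 1 = e then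
    MvPolynomial.X ⟨m 0, by omega⟩ else 0) P, fun f => ?_⟩
  change _ = MvPolynomial.eval₂Hom (RingHom.id ℂ) (binaryCoeffs f) _
  rw [MvPolynomial.eval₂Hom_bind₁]
  change MvPolynomial.eval _ P = MvPolynomial.eval _ P
  congr 2
  funext m
  rw [← homogenize_dehomogenize f, coeff_homogenize]
  split_ifs with h
  · simp [binaryCoeffs]
  · simp

theorem isSumOfPowers_iff {k d s : ℕ} (f : Form 2 (k * d)) :
    IsSumOfPowers k d s f ↔ ∃ x : Fin s × Fin (d + 1) → ℂ,
      ∀ j, MvPolynomial.eval x (sumPowCoeff k d s (k * d) j) = binaryCoeffs f j := by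
  simp only [eval_sumPowCoeff]
  constructor
  · rintro ⟨g, hg⟩
    refine ⟨fun il => binaryCoeffs (g il.1) il.2, fun j => ?_⟩
    rw [binaryCoeffs, hg, map_sum]
    simp only [map_pow, ← ofCoeffs_binaryCoeffs]
  · rintro ⟨x, hx⟩
    refine ⟨fun i => binaryForm fun l => x (i, l), ?_⟩
    set F : Form 2 (k * d) := ⟨∑ i, (binaryForm fun l => x (i, l) : MvPolynomial (Fin 2) ℂ) ^ k,
      Submodule.sum_mem _ fun i _ => by
        rw [mul_comm]
        exact MvPolynomial.IsHomogeneous.pow (binaryForm fun l => x (i, l)).2 k⟩ with hF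
    have : binaryCoeffs F = binaryCoeffs f := by
      funext j
      rw [← hx, binaryCoeffs, hF]
      simp only [map_sum, map_pow, dehomogenize_binaryForm]
    rw [← binaryForm_binaryCoeffs f, ← this, binaryForm_binaryCoeffs]

/-! ### Sums of powers, secant cones and general forms -/

theorem IsSumOfPowers.mono {n k d s t : ℕ} (hk : k ≠ 0) (hst : s ≤ t) {f : Form n (k * d)}
    (h : IsSumOfPowers k d s f) : IsSumOfPowers k d t f := by
  obtain ⟨g, hg⟩ := h
  obtain ⟨u, rfl⟩ := Nat.exists_eq_add_of_le hst
  refine ⟨Fin.append g fun _ => 0, ?_⟩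
  rw [hg, Fin.sum_univ_add]
  simp [hk]

/-- Each coefficient of the linear combination has a k-th root in ℂ, which is absorbed into its
form. -/
theorem isSumOfPowers_of_mem_span {n k d s : ℕ} (hk : k ≠ 0) {f : Form n (k * d)}
    {g : Fin s → Form n d} (h : (f : MvPolynomial (Fin n) ℂ) ∈
      Submodule.span ℂ (Set.range fun i => (g i : MvPolynomial (Fin n) ℂ) ^ k)) :
    IsSumOfPowers k d s f := by
  obtain ⟨c, hc⟩ := (Submodule.mem_span_range_iff_exists_fun ℂ).1 h
  choose b hb using fun i => IsAlgClosed.exists_pow_nat_eq (c i) (Nat.pos_of_ne_zero hk)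
  refine ⟨fun i => b i • g i, ?_⟩
  simp [← hc, _root_.smul_pow, hb]

theorem IsSumOfPowers.mem_secantCone {n k d s : ℕ} {f : Form n (k * d)}
    (h : IsSumOfPowers k d s f) : f ∈ secantCone n k d s := by
  obtain ⟨g, hg⟩ := h
  refine fun P hP => hP f ⟨g, ?_⟩
  rw [hg]
  exact Submodule.sum_mem _ fun i _ => Submodule.subset_span ⟨i, rfl⟩

theorem evalCoeffs_mul {n e : ℕ} (P Q : MvPolynomial (Fin n →₀ ℕ) ℂ) (f : Form n e) :
    evalCoeffs (P * Q) f = evalCoeffs P f * evalCoeffs Q f :=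
  map_mul _ _ _

/-- The space of binary forms is irreducible in the Zariski topology. -/
theorem exists_evalCoeffs_mul_ne_zero {e : ℕ} {P Q : MvPolynomial (Fin 2 →₀ ℕ) ℂ}
    (hP : ∃ f : Form 2 e, evalCoeffs P f ≠ 0) (hQ : ∃ f : Form 2 e, evalCoeffs Q f ≠ 0) :
    ∃ f : Form 2 e, evalCoeffs (P * Q) f ≠ 0 := by
  obtain ⟨P', hP'⟩ := exists_evalCoeffs_eq_eval (e := e) P
  obtain ⟨Q', hQ'⟩ := exists_evalCoeffs_eq_eval (e := e) Q
  by_contra! h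
  have h0 : P' * Q' = 0 := MvPolynomial.funext fun c => by
    have := h (binaryForm c)
    rwa [evalCoeffs_mul, hP', hQ', binaryCoeffs_binaryForm, ← map_mul, ← map_zero
      (MvPolynomial.eval c)] at this
  rcases mul_eq_zero.1 h0 with h0 | h0
  · obtain ⟨f, hf⟩ := hP
    exact hf (by rw [hP', h0, map_zero])
  · obtain ⟨f, hf⟩ := hQ
    exact hf (by rw [hQ', h0, map_zero])

/-- By irreducibility, the open set of sums of powers meets the nonvanishing locus of any `Q` that
is not identically zero. -/
theorem secantCone_eq_univ_of_holdsForGeneralForm {k d s : ℕ}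
    (h : HoldsForGeneralForm fun f : Form 2 (k * d) => IsSumOfPowers k d s f) :
    secantCone 2 k d s = Set.univ := by
  obtain ⟨P, hP, hs⟩ := h
  refine Set.eq_univ_of_forall fun f Q hQ => ?_
  by_contra hf
  obtain ⟨f', hf'⟩ := exists_evalCoeffs_mul_ne_zero hP ⟨f, hf⟩
  rw [evalCoeffs_mul, mul_ne_zero_iff] at hf'
  exact hf'.2 ((hs f' hf'.1).mem_secantCone Q hQ)

theorem holdsForGeneralForm_isSumOfPowers {k d s : ℕ} (hk : k ≠ 0)
    (hs : k * d + 1 ≤ s * (d + 1)) :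
    HoldsForGeneralForm fun f : Form 2 (k * d) => IsSumOfPowers k d s f := by
  obtain ⟨k, rfl⟩ := Nat.exists_eq_succ_of_ne_zero hk
  obtain ⟨x, hx⟩ := exists_range_fderiv_sumPowCoeff_eq_top k d s hs
  obtain ⟨Q, hQ, hsum⟩ :=
    (algebraicIndependent_of_range_fderiv_eq_top x hx).exists_forall_eval_ne_zero_exists_eval_eq
  obtain ⟨c, hc⟩ : ∃ c, MvPolynomial.eval c Q ≠ 0 := by
    by_contra! h
    exact hQ (MvPolynomial.funext fun c => by rw [h c, map_zero])
  refine ⟨MvPolynomial.rename (binaryExponent _) Q, ⟨binaryForm c, ?_⟩, fun f hf => ?_⟩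
  · rwa [evalCoeffs_rename, binaryCoeffs_binaryForm]
  · rw [evalCoeffs_rename] at hf
    exact (isSumOfPowers_iff f).2 (hsum _ hf)

/-- If there are too few summands for a parameter count, then some nonzero polynomial function
vanishes on all sums of `k`-th powers. -/
theorem exists_evalCoeffs_ne_zero_of_lt {k d s : ℕ} (hs : s * (d + 1) < k * d + 1) :
    ∃ P : MvPolynomial (Fin 2 →₀ ℕ) ℂ, (∃ f : Form 2 (k * d), evalCoeffs P f ≠ 0) ∧
      ∀ f : Form 2 (k * d), IsSumOfPowers k d s f → evalCoeffs P f = 0 := by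
  have hdep : ¬ AlgebraicIndependent ℂ (sumPowCoeff k d s (k * d)) := by
    intro h
    have := h.cardinalMk_le_trdeg
    rw [MvPolynomial.trdeg_of_isDomain, Cardinal.lift_id, Cardinal.mk_fintype, Cardinal.mk_fintype,
      Nat.cast_le] at this
    simp at this
    omega
  rw [algebraicIndependent_iff] at hdep
  push Not at hdep
  obtain ⟨Q, hQ0, hQ⟩ := hdep
  obtain ⟨c, hc⟩ : ∃ c, MvPolynomial.eval c Q ≠ 0 := by
    by_contra! h
    exact hQ (MvPolynomial.funext fun c => by rw [h c, map_zero])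
  refine ⟨MvPolynomial.rename (binaryExponent _) Q, ⟨binaryForm c, ?_⟩, fun f hf => ?_⟩
  · rwa [evalCoeffs_rename, binaryCoeffs_binaryForm]
  · obtain ⟨x, hx⟩ := (isSumOfPowers_iff f).1 hf
    rw [evalCoeffs_rename, ← funext hx]
    have := congrArg (MvPolynomial.eval x) hQ0
    rw [map_zero, MvPolynomial.aeval_def, MvPolynomial.algebraMap_eq,
      MvPolynomial.eval₂_eq'] at this
    rw [MvPolynomial.eval_eq', ← this]
    simp

theorem le_of_secantCone_eq_univ {k d s : ℕ} (hk : k ≠ 0) (h : secantCone 2 k d s = Set.univ) :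
    k * d + 1 ≤ s * (d + 1) := by
  by_contra! hs
  obtain ⟨P, ⟨f, hf⟩, hP⟩ := exists_evalCoeffs_ne_zero_of_lt hs
  have hmem : f ∈ secantCone 2 k d s := h ▸ Set.mem_univ f
  exact hf (hmem P fun f' ⟨_, hg⟩ => hP f' (isSumOfPowers_of_mem_span hk hg))

theorem sInf_natCast_eq {p : ℕ → Prop} {r : ℕ} (h : IsLeast {s | p s} r) :
    sInf {t : ℕ∞ | ∃ s : ℕ, t = s ∧ p s} = r := by
  refine IsLeast.csInf_eq ⟨⟨r, rfl, h.1⟩, ?_⟩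
  rintro _ ⟨s, rfl, hs⟩
  exact_mod_cast h.2 hs

theorem theorem2p3 (k d : ℕ) (hk : 2 ≤ k) (hd : 2 ≤ d) :
    genericKRank 2 k d = (⌈((k : ℚ) * d + 1) / (d + 1)⌉₊ : ℕ∞) ∧
    (HoldsForGeneralForm fun f : Form 2 (k * d) =>
      kRank k d f = (⌈((k : ℚ) * d + 1) / (d + 1)⌉₊ : ℕ∞)) ∧
    IsLeast {s : ℕ | secantCone 2 k d s = Set.univ} ⌈((k : ℚ) * d + 1) / (d + 1)⌉₊ := by
  have hk0 : k ≠ 0 := by omega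
  have hceil : ∀ s : ℕ, ⌈((k : ℚ) * d + 1) / (d + 1)⌉₊ ≤ s ↔ k * d + 1 ≤ s * (d + 1) := by
    intro s
    rw [Nat.ceil_le, div_le_iff₀ (by positivity)]
    exact_mod_cast Iff.rfl
  -- Only the equivalence `hceil` is used from here on.
  generalize ⌈((k : ℚ) * d + 1) / (d + 1)⌉₊ = r at hceil
  have hgen := holdsForGeneralForm_isSumOfPowers hk0 ((hceil r).1 le_rfl)
  have hlow : ∀ s, secantCone 2 k d s = Set.univ → r ≤ s :=
    fun s hs => (hceil s).2 (le_of_secantCone_eq_univ hk0 hs)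
  refine ⟨sInf_natCast_eq ⟨hgen, fun s hs =>
    hlow s (secantCone_eq_univ_of_holdsForGeneralForm hs)⟩, ?_,
    secantCone_eq_univ_of_holdsForGeneralForm hgen, hlow⟩
  have hr0 : r ≠ 0 := by
    rintro rfl
    have := (hceil 0).1 le_rfl
    omega
  obtain ⟨P, hP, hPr⟩ := hgen
  -- Excluding r - 1 summands excludes all smaller numbers, by padding with zeros.
  obtain ⟨Q, hQ, hQr⟩ := exists_evalCoeffs_ne_zero_of_lt (k := k) (d := d) (s := r - 1)
    (not_le.1 fun h => by have := (hceil (r - 1)).2 h; omega)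
  refine ⟨P * Q, exists_evalCoeffs_mul_ne_zero hP hQ, fun f hf => ?_⟩
  rw [evalCoeffs_mul, mul_ne_zero_iff] at hf
  refine sInf_natCast_eq ⟨hPr f hf.1, fun s hs => ?_⟩
  by_contra! hlt
  exact hf.2 (hQr f (IsSumOfPowers.mono hk0 (by omega) hs))
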